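/- **Setting.** Consider a tabular episodic Markov decision process with finite state space $\mathcal S$ of size $S$, finite action space $\mathcal A$ of size $A\ge 1$, horizon $H$, transition probabilities $P_h(\cdot\mid s,a)$ for $h\in[H]$, and a fixed starting state $s_1$. A policy $\pi$ is a family of maps $\pi_h:\mathcal S\to\Delta_{\mathcal A}$, $h\in[H]$, and the reachability of $s$ at step $h$ is $\delta_h(s)=\max_\pi P^\pi(s_h=s)$, for trajectories started at $s_1$ at step $1$. **Algorithm.** The exploration phase of UCBZero with parameters $c>0$, number of tasks $N\ge 1$, number of episodes $K$ and $p\in(0,1)$ is the following. Put $\iota=\log(SAHK/p)$, $b_t=c\sqrt{H^3(\log N+\iota)/t}$ and $\alpha_t=\frac{H+1}{H+t}$. Initialize $\bar Q_h(s,a)=H$ and $N_h(s,a)=0$ for all $(s,a,h)$. In each episode $k=1,\dots,K$, start at $s_1^k=s_1$, and for $h=1,\dots,H$: take an action $a_h^k\in\arg\max_a\bar Q_h(s_h^k,a)$ (ties are broken arbitrarily), observe $s_{h+1}^k\sim P_h(\cdot\mid s_h^k,a_h^k)$, increase $N_h(s_h^k,a_h^k)$ by one, let $t$ be its new value, and set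 $$\bar Q_h(s_h^k,a_h^k)\leftarrow(1-\alpha_t)\,\bar Q_h(s_h^k,a_h^k)+\alpha_t\bigl[\bar V_{h+1}(s_{h+1}^k)+2b_t\bigr],$$ where $\bar V_{h}(s)=\min\bigl(H,\max_a\bar Q_{h}(s,a)\bigr)$ for $h\le H$ and $\bar V_{H+1}=0$. **Theorem.** There are absolute constants $c,C_1,C_2>0$ such that for every such Markov decision process, all $N\ge1$ and $K$, every $p\in(0,1)$ and every way of breaking ties, the following holds for UCBZero run with bonus constant $c$: with probability at least $1-p$, after $K$ episodes the visit counts satisfy, simultaneously for all $(s,a,h)\in\mathcal S\times\mathcal A\times[H]$ with $K\,\delta_h(s)^2\ge C_1H^3SA(\log N+\iota)$, $$N_h^K(s,a)\;\ge\; C_2\,\frac{K\,\delta_h(s)^2}{H^2SA}.$$ -/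

import Mathlib

noncomputable section

namespace UCBZero

/-- A tabular episodic MDP without rewards, with horizon `H` and fixed starting state `s₁`.
Steps are numbered `1, …, H`, and `P h s a` is the law of the next state when action `a` is taken
in state `s` at step `h`; the values of `P` at other indices `h` are never used. -/
structure EpisodicMDP (S A : Type*) where
  H : ℕ
  P : ℕ → S → A → PMF S
  s₁ : S

/-- A (stochastic, step-dependent) policy: `π h s` is the law of the action at step `h`. -/
abbrev Policy (S A : Type*) := ℕ → S → PMF A

variable {S A : Type*}

/-- The law of the state `n` steps later, for the policy `π` started in state `s` at step `h`. -/
def stateLaw (M : EpisodicMDP S A) (π : Policy S A) : ℕ → ℕ → S → PMF S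
  | 0, _, s => PMF.pure s
  | n + 1, h, s => (π h s).bind fun a => (M.P h s a).bind fun s' => stateLaw M π n (h + 1) s'

/-- Relative reachability `δ_{h',h}(s',s)` (for `h' ≤ h`): the maximal probability, over policies,
of being in `s` at step `h` given state `s'` at step `h'`. -/
def relReach (M : EpisodicMDP S A) (h' h : ℕ) (s' s : S) : ℝ :=
  (⨆ π : Policy S A, stateLaw M π (h - h') h' s' s).toReal

/-- Reachability `δ_h(s)` of state `s` at step `h`, from the starting state. -/
def reach (M : EpisodicMDP S A) (h : ℕ) (s : S) : ℝ :=
  relReach M 1 h M.s₁ s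

/-- The content of the learner's memory: the pseudo-`Q` table, the visit counts `N_h(s,a)`, and
the transitions `(h, s, a, s')` observed so far, the most recent one first. -/
structure Memory (S A : Type*) where
  Q : ℕ → S → A → ℝ
  count : ℕ → S → A → ℕ
  data : List (ℕ × S × A × S)

/-- Initialization: `Q_h(s,a) = H` and `N_h(s,a) = 0`. -/
def initMemory (S A : Type*) (H : ℕ) : Memory S A where
  Q := fun _ _ _ => H
  count := fun _ _ _ => 0
  data := []

/-- `V_h(s) = min (H, max_a Q_h(s,a))` for `h ≤ H`, and `V_{H+1} = 0`. -/
def vbar [Fintype A] [Nonempty A] (H : ℕ) (m : Memory S A) (h : ℕ) (s : S) : ℝ :=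
  if h ≤ H then min (H : ℝ) (Finset.univ.sup' Finset.univ_nonempty (m.Q h s)) else 0

/-- The logarithmic factor `log N + ι`, where `ι = log (S A H K / p)`. -/
def logFactor (S A : Type*) [Fintype S] [Fintype A] (H N K : ℕ) (p : ℝ) : ℝ :=
  Real.log N + Real.log (Fintype.card S * Fintype.card A * H * K / p)

/-- The bonus `b_t = c √(H³ L / t)`; `L` will be `logFactor`. -/
def bonus (c L : ℝ) (H t : ℕ) : ℝ :=
  c * √((H : ℝ) ^ 3 * L / t)

/-- The learning rate `α_t = (H + 1) / (H + t)`. -/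
def rate (H t : ℕ) : ℝ :=
  ((H : ℝ) + 1) / ((H : ℝ) + t)

/-- The update after observing the transition from `s` to `s'` under action `a` at step `h`. -/
def Memory.update [DecidableEq S] [DecidableEq A] [Fintype A] [Nonempty A] (m : Memory S A)
    (H : ℕ) (c L : ℝ) (h : ℕ) (s : S) (a : A) (s' : S) : Memory S A :=
  let t := m.count h s a + 1
  { count := fun i x b => if i = h ∧ x = s ∧ b = a then t else m.count i x b
    Q := fun i x b => if i = h ∧ x = s ∧ b = a then
        (1 - rate H t) * m.Q h s a + rate H t * (vbar H m (h + 1) s' + 2 * bonus c L H t)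
      else m.Q i x b
    data := (h, s, a, s') :: m.data }

/-- A rule for picking an action from the memory, the step and the current state. -/
abbrev ActionRule (S A : Type*) := Memory S A → ℕ → S → PMF A

/-- The rule only picks actions in `argmax_a Q_h(s,a)`; ties may be broken in any way, also
at random or depending on the past. -/
def IsGreedy (g : ActionRule S A) : Prop :=
  ∀ m h s, ∀ a ∈ (g m h s).support, ∀ b, m.Q h s b ≤ m.Q h s a

section Run

variable [DecidableEq S] [DecidableEq A] [Fintype A] [Nonempty A]

/-- The law of the memory after the `n` steps `h, …, h + n - 1`, when the state at step `h`
is `s` and the memory before step `h` is `m`. -/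
def runSteps (M : EpisodicMDP S A) (c L : ℝ) (g : ActionRule S A) :
    ℕ → ℕ → S → Memory S A → PMF (Memory S A)
  | 0, _, _, m => PMF.pure m
  | n + 1, h, s, m =>
    (g m h s).bind fun a => (M.P h s a).bind fun s' =>
      runSteps M c L g n (h + 1) s' (m.update M.H c L h s a s')

/-- The law of the memory after `k` episodes, each of which consists of the steps `1, …, H`
and starts in `s₁`. -/
def runEpisodes (M : EpisodicMDP S A) (c L : ℝ) (g : ActionRule S A) : ℕ → PMF (Memory S A)
  | 0 => PMF.pure (initMemory S A M.H)
  | k + 1 => (runEpisodes M c L g k).bind fun m => runSteps M c L g M.H 1 M.s₁ m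

/-- The law of the memory after the exploration phase of UCBZero with `K` episodes, `N` tasks,
failure probability `p`, bonus constant `c`, and action rule `g`. -/
def ucbZero [Fintype S] (M : EpisodicMDP S A) (c : ℝ) (N K : ℕ) (p : ℝ) (g : ActionRule S A) :
    PMF (Memory S A) :=
  runEpisodes M c (logFactor S A M.H N K p) g K

end Run

end UCBZero

end

/-
By Azuma's inequality, with high probability the learning-rate averages of the reachabilities
`δ_{h,i}(s_h, s)` of the observed states are, at every stage of the run, at least their means
minus the bonuses. On this event `V̄` is optimistic: as long as every bonus received by
`(s, a)` at step `h` was at least `B / 2`, the value function for reward `B` in state `s` at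
step `h` stays below `V̄`, so `B * δ_h(s) ≤ V̄_1(s₁)`. On the other hand, an update of
`Q̄_i(s,a)` changes the potential `∑ (1 + N_i(s,a) / H) Q̄_i(s,a)` by
`(1 + 1 / H) (V̄_{i+1}(s') + 2 b) - Q̄_i(s,a)`. Since the potential is nonnegative and actions
are greedy, the values `V̄_i` along the run sum to at most `1 + 1 / H` times the sum of the
values `V̄_{i+1}` and the bonuses, and iterating over `i` gives
`∑_k V̄_1(s₁) = O(√(H⁵ S A K L))` with `L = log N + ι`. If `N_h(s,a)` were small, `B` could be
chosen too large for both bounds to hold.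
-/

noncomputable section

namespace UCBZero

open scoped ENNReal

section Expectation

variable {α β : Type*}

/-- The expectation of a nonnegative function under a probability mass function. -/
def expect (p : PMF α) (f : α → ℝ≥0∞) : ℝ≥0∞ := ∑' a, p a * f a

theorem expect_pure (a : α) (f : α → ℝ≥0∞) : expect (PMF.pure a) f = f a := by
  classical
  rw [expect, tsum_eq_single a fun b hb => by simp [PMF.pure_apply, hb]]
  simp

theorem expect_bind (p : PMF α) (q : α → PMF β) (f : β → ℝ≥0∞) :
    expect (p.bind q) f = expect p fun a => expect (q a) f := by
  simp_rw [expect, PMF.bind_apply, ← ENNReal.tsum_mul_right, ← ENNReal.tsum_mul_left]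
  rw [ENNReal.tsum_comm]
  simp_rw [mul_assoc]

theorem expect_const (p : PMF α) (c : ℝ≥0∞) : expect p (fun _ => c) = c := by
  rw [expect, ENNReal.tsum_mul_right, p.tsum_coe, one_mul]

theorem expect_mono (p : PMF α) {f g : α → ℝ≥0∞} (h : ∀ a, f a ≤ g a) :
    expect p f ≤ expect p g :=
  ENNReal.tsum_le_tsum fun a => mul_le_mul_right (h a) _

theorem expect_le_of_forall_le (p : PMF α) {f : α → ℝ≥0∞} {c : ℝ≥0∞} (h : ∀ a, f a ≤ c) :
    expect p f ≤ c :=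
  (expect_mono p h).trans_eq (expect_const p c)

theorem mul_toOuterMeasure_le_expect (p : PMF α) {f : α → ℝ≥0∞} {s : Set α} {r : ℝ≥0∞}
    (hs : ∀ a ∈ s, r ≤ f a) : r * p.toOuterMeasure s ≤ expect p f := by
  rw [PMF.toOuterMeasure_apply, ← ENNReal.tsum_mul_left]
  refine ENNReal.tsum_le_tsum fun a => ?_
  by_cases ha : a ∈ s
  · simpa [ha, mul_comm r] using mul_le_mul_right (hs a ha) (p a)
  · simp [ha]

theorem ofReal_one_sub_le_toOuterMeasure (p : PMF α) {s t : Set α} {q : ℝ} (hq : 0 ≤ q)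
    (ht : p.toOuterMeasure t ≤ ENNReal.ofReal q) (hst : ∀ a ∈ p.support, a ∉ t → a ∈ s) :
    ENNReal.ofReal (1 - q) ≤ p.toOuterMeasure s := by
  rw [ENNReal.ofReal_sub _ hq, ENNReal.ofReal_one, tsub_le_iff_right]
  calc (1 : ℝ≥0∞) = p.toOuterMeasure Set.univ := by
        rw [PMF.toOuterMeasure_apply, Set.indicator_univ, p.tsum_coe]
    _ ≤ p.toOuterMeasure (s ∪ t) := by
        refine PMF.toOuterMeasure_mono p fun a ha => ?_
        by_cases h : a ∈ t
        · exact Or.inr h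
        · exact Or.inl (hst a ha.2 h)
    _ ≤ p.toOuterMeasure s + p.toOuterMeasure t := MeasureTheory.measure_union_le s t
    _ ≤ p.toOuterMeasure s + ENNReal.ofReal q := by gcongr

variable [Fintype α]

/-- The expectation of a real function under a probability mass function on a finite type. -/
def mean (p : PMF α) (f : α → ℝ) : ℝ := ∑ a, (p a).toReal * f a

theorem mean_const (p : PMF α) (c : ℝ) : mean p (fun _ => c) = c := by
  rw [mean, ← Finset.sum_mul, ← ENNReal.toReal_sum fun a _ => p.apply_ne_top a,
    ← tsum_fintype (L := .unconditional _), p.tsum_coe, ENNReal.toReal_one, one_mul]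

theorem mean_mono (p : PMF α) {f g : α → ℝ} (h : ∀ a, f a ≤ g a) : mean p f ≤ mean p g :=
  Finset.sum_le_sum fun a _ => mul_le_mul_of_nonneg_left (h a) ENNReal.toReal_nonneg

theorem mean_const_mul (p : PMF α) (c : ℝ) (f : α → ℝ) :
    mean p (fun a => c * f a) = c * mean p f := by
  simp_rw [mean, Finset.mul_sum, mul_left_comm]

theorem expect_ofReal (p : PMF α) {f : α → ℝ} (hf : ∀ a, 0 ≤ f a) :
    expect p (fun a => ENNReal.ofReal (f a)) = ENNReal.ofReal (mean p f) := by
  rw [expect, tsum_fintype, mean, ENNReal.ofReal_sum_of_nonneg fun a _ =>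
    mul_nonneg ENNReal.toReal_nonneg (hf a)]
  refine Finset.sum_congr rfl fun a _ => ?_
  rw [ENNReal.ofReal_mul ENNReal.toReal_nonneg, ENNReal.ofReal_toReal (p.apply_ne_top a)]

theorem mean_exp_le (p : PMF α) {f : α → ℝ} (hf : ∀ a, f a ∈ Set.Icc 0 1) (θ : ℝ) :
    mean p (fun a => Real.exp (θ * (f a - mean p f))) ≤ Real.exp (θ ^ 2 / 8) := by
  let _ : MeasurableSpace α := ⊤
  have integral_eq (u : α → ℝ) : ∫ a, u a ∂p.toMeasure = mean p u := p.integral_eq_sum u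
  have h := (ProbabilityTheory.hasSubgaussianMGF_of_mem_Icc (μ := p.toMeasure)
    measurable_from_top.aemeasurable (.of_forall hf)).mgf_le θ
  simp only [ProbabilityTheory.mgf, integral_eq] at h
  refine h.trans_eq ?_
  norm_num
  ring

end Expectation

section Reachability

variable {S A : Type*} (M : EpisodicMDP S A)

theorem relReach_nonneg (h' h : ℕ) (s' s : S) : 0 ≤ relReach M h' h s' s :=
  ENNReal.toReal_nonneg

theorem iSup_stateLaw_le_one (n h : ℕ) (s' s : S) :
    ⨆ π : Policy S A, stateLaw M π n h s' s ≤ 1 :=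
  iSup_le fun _ => PMF.coe_le_one _ _

theorem relReach_le_one (h' h : ℕ) (s' s : S) : relReach M h' h s' s ≤ 1 :=
  ENNReal.toReal_le_of_le_ofReal zero_le_one (by simpa using iSup_stateLaw_le_one M _ _ s' s)

theorem relReach_mem_Icc (h' h : ℕ) (s' s : S) : relReach M h' h s' s ∈ Set.Icc 0 1 :=
  ⟨relReach_nonneg M h' h s' s, relReach_le_one M h' h s' s⟩

theorem relReach_self_of_ne {h : ℕ} {s' s : S} (hs : s' ≠ s) : relReach M h h s' s = 0 := by
  simp [relReach, stateLaw, PMF.pure_apply_of_ne _ _ hs.symm]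

theorem mean_relReach_le_one [Fintype S] (p : PMF S) (h' h : ℕ) (s : S) :
    mean p (relReach M h' h · s) ≤ 1 :=
  (mean_mono p fun y => relReach_le_one M h' h y s).trans_eq (mean_const p 1)

theorem stateLaw_le_ofReal_relReach (π : Policy S A) (h' h : ℕ) (s' s : S) :
    stateLaw M π (h - h') h' s' s ≤ ENNReal.ofReal (relReach M h' h s' s) := by
  rw [relReach, ENNReal.ofReal_toReal
    ((iSup_stateLaw_le_one M _ _ s' s).trans_lt ENNReal.one_lt_top).ne]
  exact le_iSup (fun π : Policy S A => stateLaw M π (h - h') h' s' s) π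

theorem relReach_le_of_forall_mean_le [Fintype S] {h' h : ℕ} (hh : h' < h) {s' s : S} {v : ℝ}
    (hv : 0 ≤ v) (hmean : ∀ a, mean (M.P h' s' a) (relReach M (h' + 1) h · s) ≤ v) :
    relReach M h' h s' s ≤ v := by
  refine ENNReal.toReal_le_of_le_ofReal hv (iSup_le fun π => ?_)
  rw [show h - h' = h - (h' + 1) + 1 by omega, stateLaw, PMF.bind_apply]
  refine expect_le_of_forall_le (π h' s') fun a => ?_
  rw [PMF.bind_apply]
  calc expect (M.P h' s' a) (fun x => stateLaw M π (h - (h' + 1)) (h' + 1) x s)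
      ≤ expect (M.P h' s' a) (fun x => ENNReal.ofReal (relReach M (h' + 1) h x s)) :=
        expect_mono _ fun x => stateLaw_le_ofReal_relReach M π (h' + 1) h x s
    _ = ENNReal.ofReal (mean (M.P h' s' a) (relReach M (h' + 1) h · s)) :=
        expect_ofReal _ fun x => relReach_nonneg M _ _ x s
    _ ≤ ENNReal.ofReal v := ENNReal.ofReal_le_ofReal (hmean a)

end Reachability

section RunningAverage

/-- The running average with learning rates `α 1, α 2, …` of a list of samples, of which the most
recent comes first. -/
def runAvg (α : ℕ → ℝ) : List ℝ → ℝ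
  | [] => 0
  | x :: u => (1 - α (u.length + 1)) * runAvg α u + α (u.length + 1) * x

/-- The sum of the squares of the weights that the first `n` samples have in `runAvg α`. -/
def sqWeight (α : ℕ → ℝ) : ℕ → ℝ
  | 0 => 0
  | n + 1 => (1 - α (n + 1)) ^ 2 * sqWeight α n + α (n + 1) ^ 2

/-- The factor by which the weight of a sample in `runAvg α` shrinks between times `n` and `t`. -/
def decay (α : ℕ → ℝ) (n t : ℕ) : ℝ := ∏ j ∈ Finset.Ico n t, (1 - α (j + 1))

theorem decay_self (α : ℕ → ℝ) (t : ℕ) : decay α t t = 1 := by simp [decay]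

theorem decay_of_lt (α : ℕ → ℝ) {n t : ℕ} (h : n < t) :
    decay α n t = (1 - α (n + 1)) * decay α (n + 1) t :=
  Finset.prod_eq_prod_Ico_succ_bot h _

theorem decay_zero {α : ℕ → ℝ} (hα : α 1 = 1) {t : ℕ} (ht : 0 < t) : decay α 0 t = 0 := by
  simp [decay_of_lt α ht, hα]

theorem runAvg_map_const_mul {β : Type*} (α : ℕ → ℝ) (B : ℝ) (f : β → ℝ) (l : List β) :
    runAvg α (l.map fun y => B * f y) = B * runAvg α (l.map f) := by
  induction l with
  | nil => simp [runAvg]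
  | cons y l ih =>
    simp only [List.map_cons, runAvg, List.length_map, ih]
    ring

theorem runAvg_map_zero {β : Type*} (α : ℕ → ℝ) (l : List β) :
    runAvg α (l.map fun _ => 0) = 0 := by
  simpa using runAvg_map_const_mul α 0 (fun _ => 0) l

/-- The exponential supermartingale with parameter `θ` behind the Chernoff bound for the deviation
from `μ` of the running average of `t` samples, as a function of the first samples. -/
def chernoff (α : ℕ → ℝ) (θ μ : ℝ) (t : ℕ) (u : List ℝ) : ℝ :=
  Real.exp (-(θ * decay α u.length t * (runAvg α u - μ))
    - (θ * decay α u.length t) ^ 2 * sqWeight α u.length / 8)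

theorem chernoff_nonneg (α : ℕ → ℝ) (θ μ : ℝ) (t : ℕ) (u : List ℝ) : 0 ≤ chernoff α θ μ t u :=
  (Real.exp_pos _).le

theorem chernoff_nil {α : ℕ → ℝ} (hα : α 1 = 1) (θ μ : ℝ) {t : ℕ} (ht : 0 < t) :
    chernoff α θ μ t [] = 1 := by
  simp [chernoff, decay_zero hα ht]

theorem chernoff_cons (α : ℕ → ℝ) (θ μ x : ℝ) {t : ℕ} {u : List ℝ} (hu : u.length < t) :
    chernoff α θ μ t (x :: u) = chernoff α θ μ t u
      * Real.exp (-((θ * decay α (u.length + 1) t * α (u.length + 1)) ^ 2 / 8))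
      * Real.exp (-(θ * decay α (u.length + 1) t * α (u.length + 1)) * (x - μ)) := by
  simp only [chernoff, List.length_cons, decay_of_lt α hu, runAvg, sqWeight]
  rw [← Real.exp_add, ← Real.exp_add]
  ring_nf

theorem mean_chernoff_cons_le {β : Type*} [Fintype β] (α : ℕ → ℝ) (p : PMF β) {f : β → ℝ}
    (hf : ∀ y, f y ∈ Set.Icc 0 1) (θ : ℝ) {t : ℕ} {u : List ℝ} (hu : u.length < t) :
    mean p (fun y => chernoff α θ (mean p f) t (f y :: u)) ≤ chernoff α θ (mean p f) t u := by
  simp_rw [chernoff_cons α θ _ _ hu, mean_const_mul]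
  set κ := θ * decay α (u.length + 1) t * α (u.length + 1)
  rw [mul_assoc]
  refine mul_le_of_le_one_right (chernoff_nonneg _ _ _ _ _) ?_
  calc Real.exp (-(κ ^ 2 / 8)) * mean p (fun y => Real.exp (-κ * (f y - mean p f)))
      ≤ Real.exp (-(κ ^ 2 / 8)) * Real.exp ((-κ) ^ 2 / 8) := by gcongr; exact mean_exp_le p hf _
    _ = 1 := by rw [← Real.exp_add]; simp

/-- `θ = 4 ε / v` is the optimal parameter. -/
theorem exp_le_chernoff {α : ℕ → ℝ} {μ ε v : ℝ} {u : List ℝ} (hε : 0 ≤ ε) (hv : 0 < v)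
    (hsq : sqWeight α u.length ≤ v) (hu : runAvg α u < μ - ε) :
    Real.exp (2 * ε ^ 2 / v) ≤ chernoff α (4 * ε / v) μ u.length u := by
  rw [chernoff, decay_self, mul_one, Real.exp_le_exp]
  calc 2 * ε ^ 2 / v = -(4 * ε / v * -ε) - (4 * ε / v) ^ 2 * v / 8 := by field_simp; ring
    _ ≤ _ := by gcongr; linarith

end RunningAverage

section Rate

theorem rate_one (H : ℕ) : rate H 1 = 1 := by
  rw [rate, Nat.cast_one]
  exact div_self (by positivity)

theorem rate_nonneg (H t : ℕ) : 0 ≤ rate H t := by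
  rw [rate]; positivity

theorem one_sub_rate_succ (H n : ℕ) : 1 - rate H (n + 1) = n / ((H : ℝ) + n + 1) := by
  rw [rate]
  push_cast
  field_simp
  ring

theorem one_sub_rate_succ_nonneg (H n : ℕ) : 0 ≤ 1 - rate H (n + 1) := by
  rw [one_sub_rate_succ]; positivity

theorem mul_sqWeight_rate_le {H : ℕ} (hH : 1 ≤ H) (n : ℕ) : n * sqWeight (rate H) n ≤ 2 * H := by
  have one_le_H : (1 : ℝ) ≤ H := by exact_mod_cast hH
  induction n with
  | zero => simp [sqWeight]
  | succ n ih =>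
    have recursion : ((n + 1 : ℕ) : ℝ) * sqWeight (rate H) (n + 1)
        = (n + 1) * (n * (n * sqWeight (rate H) n) + (H + 1) ^ 2) / ((H : ℝ) + n + 1) ^ 2 := by
      rw [sqWeight, one_sub_rate_succ, rate]
      push_cast
      field_simp
      ring
    rw [recursion, div_le_iff₀ (by positivity)]
    calc ((n : ℝ) + 1) * (n * (n * sqWeight (rate H) n) + (H + 1) ^ 2)
        ≤ (n + 1) * (n * (2 * (H : ℝ)) + (H + 1) ^ 2) := by gcongr
      _ ≤ 2 * H * ((H : ℝ) + n + 1) ^ 2 := by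
        have : 0 ≤ ((n : ℝ) + 1) * (H ^ 2 - 1) := mul_nonneg (by positivity) (by nlinarith)
        have : 0 ≤ ((n : ℝ) + 1) * H ^ 2 := by positivity
        have : (0 : ℝ) ≤ H ^ 3 := by positivity
        nlinarith

theorem sqWeight_rate_le {H n : ℕ} (hH : 1 ≤ H) (hn : 0 < n) :
    sqWeight (rate H) n ≤ 2 * H / n := by
  rw [le_div_iff₀ (by positivity), mul_comm]
  exact mul_sqWeight_rate_le hH n

end Rate

section History

/-- The transitions `(h, s, a, s')` observed so far, the most recent one first, as in
`Memory.data`. -/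
abbrev History (S A : Type*) := List (ℕ × S × A × S)

variable {S A : Type*} [DecidableEq S] [DecidableEq A]

/-- The states observed after taking action `a` in state `s` at step `h`, the most recent one
first. -/
def nextStates (h : ℕ) (s : S) (a : A) (l : History S A) : List S :=
  l.filterMap fun (h₀, s₀, a₀, s') => if h = h₀ ∧ s = s₀ ∧ a = a₀ then some s' else none

/-- The visit count `N_h(s,a)`. -/
def visits (h : ℕ) (s : S) (a : A) (l : History S A) : ℕ := (nextStates h s a l).length

theorem nextStates_cons_self (h : ℕ) (s : S) (a : A) (s' : S) (l : History S A) :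
    nextStates h s a ((h, s, a, s') :: l) = s' :: nextStates h s a l := by
  simp [nextStates]

theorem nextStates_cons_of_ne {h h₀ : ℕ} {s s₀ : S} {a a₀ : A}
    (hne : ¬(h = h₀ ∧ s = s₀ ∧ a = a₀)) (s' : S) (l : History S A) :
    nextStates h s a ((h₀, s₀, a₀, s') :: l) = nextStates h s a l := by
  simp [nextStates, hne]

theorem visits_nil (h : ℕ) (s : S) (a : A) : visits h s a [] = 0 := rfl

theorem visits_cons_self (h : ℕ) (s : S) (a : A) (s' : S) (l : History S A) :
    visits h s a ((h, s, a, s') :: l) = visits h s a l + 1 := by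
  rw [visits, nextStates_cons_self, List.length_cons, visits]

theorem visits_cons_of_ne {h h₀ : ℕ} {s s₀ : S} {a a₀ : A}
    (hne : ¬(h = h₀ ∧ s = s₀ ∧ a = a₀)) (s' : S) (l : History S A) :
    visits h s a ((h₀, s₀, a₀, s') :: l) = visits h s a l := by
  rw [visits, nextStates_cons_of_ne hne, visits]

theorem visits_le_of_suffix (h : ℕ) (s : S) (a : A) {l' l : History S A} (hl : l' <:+ l) :
    visits h s a l' ≤ visits h s a l :=
  (hl.filterMap _).length_le

theorem nextStates_suffix_of_suffix (h : ℕ) (s : S) (a : A) {l' l : History S A} (hl : l' <:+ l) :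
    nextStates h s a l' <:+ nextStates h s a l :=
  hl.filterMap _

end History

section Concentration

theorem rtake_eq_self {β : Type*} {l : List β} {n : ℕ} (h : l.length ≤ n) : l.rtake n = l := by
  rw [List.rtake, Nat.sub_eq_zero_of_le h, List.drop_zero]

theorem rtake_cons_of_le {β : Type*} (y : β) {l : List β} {n : ℕ} (h : n ≤ l.length) :
    (y :: l).rtake n = l.rtake n := by
  rw [List.rtake, List.rtake, List.length_cons, Nat.succ_sub h, List.drop_succ_cons]

theorem rtake_length_of_suffix {β : Type*} {l' l : List β} (h : l' <:+ l) :
    l.rtake l'.length = l' :=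
  (List.suffix_iff_eq_drop.1 h).symm

variable {S A : Type*} [DecidableEq S] [DecidableEq A] (M : EpisodicMDP S A)

theorem expect_chernoff_cons_le [Fintype S] (α : ℕ → ℝ) {f : S → ℝ}
    (hf : ∀ y, f y ∈ Set.Icc 0 1) (θ : ℝ) (t h : ℕ) (s : S) (a : A) (h₀ : ℕ) (s₀ : S) (a₀ : A)
    (l : History S A) :
    expect (M.P h₀ s₀ a₀) (fun s' => ENNReal.ofReal (chernoff α θ (mean (M.P h s a) f) t
        (((nextStates h s a ((h₀, s₀, a₀, s') :: l)).rtake t).map f)))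
      ≤ ENNReal.ofReal (chernoff α θ (mean (M.P h s a) f) t
          (((nextStates h s a l).rtake t).map f)) := by
  by_cases hvisit : h = h₀ ∧ s = s₀ ∧ a = a₀
  · obtain ⟨rfl, rfl, rfl⟩ := hvisit
    simp_rw [nextStates_cons_self]
    rcases le_or_gt t (nextStates h s a l).length with ht | ht
    · simp_rw [rtake_cons_of_le _ ht, expect_const, le_refl]
    · rw [expect_ofReal _ fun _ => chernoff_nonneg _ _ _ _ _]
      refine ENNReal.ofReal_le_ofReal ?_
      simp_rw [rtake_eq_self ht.le, rtake_eq_self (List.length_cons.trans_le ht), List.map_cons]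
      exact mean_chernoff_cons_le α _ hf θ (by rwa [List.length_map])
  · simp_rw [nextStates_cons_of_ne hvisit, expect_const, le_refl]

variable [Fintype A] [Nonempty A] (c L : ℝ) (g : ActionRule S A)

theorem expect_runSteps_le {F : History S A → ℝ≥0∞}
    (hF : ∀ h s a l, expect (M.P h s a) (fun s' => F ((h, s, a, s') :: l)) ≤ F l)
    (n h : ℕ) (s : S) (m : Memory S A) :
    expect (runSteps M c L g n h s m) (fun m' => F m'.data) ≤ F m.data := by
  induction n generalizing h s m with
  | zero => rw [runSteps, expect_pure]
  | succ n ih =>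
    rw [runSteps, expect_bind]
    refine expect_le_of_forall_le _ fun a => ?_
    rw [expect_bind]
    exact (expect_mono _ fun s' => ih (h + 1) s' _).trans (hF h s a m.data)

theorem expect_runEpisodes_le {F : History S A → ℝ≥0∞}
    (hF : ∀ h s a l, expect (M.P h s a) (fun s' => F ((h, s, a, s') :: l)) ≤ F l) (k : ℕ) :
    expect (runEpisodes M c L g k) (fun m => F m.data) ≤ F [] := by
  induction k with
  | zero => rw [runEpisodes, expect_pure, initMemory]
  | succ k ih =>
    rw [runEpisodes, expect_bind]
    exact (expect_mono _ fun m => expect_runSteps_le M c L g hF _ _ _ m).trans ih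

variable [Fintype S]

theorem toOuterMeasure_runAvg_lt_le (k : ℕ) {α : ℕ → ℝ} (hα : α 1 = 1) {f : S → ℝ}
    (hf : ∀ y, f y ∈ Set.Icc 0 1) (h : ℕ) (s : S) (a : A) {t : ℕ} (ht : 0 < t) {ε v : ℝ}
    (hε : 0 ≤ ε) (hv : 0 < v) (hsq : sqWeight α t ≤ v) :
    (runEpisodes M c L g k).toOuterMeasure {m | ∃ ys, ys <:+ nextStates h s a m.data ∧
        ys.length = t ∧ runAvg α (ys.map f) < mean (M.P h s a) f - ε}
      ≤ ENNReal.ofReal (Real.exp (-(2 * ε ^ 2 / v))) := by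
  rw [Real.exp_neg, ENNReal.ofReal_inv_of_pos (Real.exp_pos _), ENNReal.le_inv_iff_mul_le,
    mul_comm]
  refine (mul_toOuterMeasure_le_expect _ ?_).trans ((expect_runEpisodes_le M c L g
    (expect_chernoff_cons_le M α hf (4 * ε / v) t h s a) k).trans_eq ?_)
  · rintro m ⟨ys, hys, rfl, hlt⟩
    refine ENNReal.ofReal_le_ofReal ?_
    rw [rtake_length_of_suffix hys, ← List.length_map f]
    exact exp_le_chernoff hε hv (by rwa [List.length_map]) hlt
  · rw [show nextStates h s a [] = [] from rfl, List.rtake_nil, List.map_nil,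
      chernoff_nil hα _ _ ht, ENNReal.ofReal_one]

/-- Along the history and all its earlier stages, the learning-rate averages of the reachabilities
of the next states are not much smaller than their means. -/
def Concentrated (ι : ℝ) (l : History S A) : Prop :=
  ∀ h' s' a h s, 1 ≤ h' → h' < h → h ≤ M.H → ∀ ys, ys <:+ nextStates h' s' a l → ys ≠ [] →
    mean (M.P h' s' a) (relReach M (h' + 1) h · s) - √(2 * M.H * ι / ys.length)
      ≤ runAvg (rate M.H) (ys.map (relReach M (h' + 1) h · s))

theorem toOuterMeasure_runAvg_relReach_lt_le (k : ℕ) {ι : ℝ} (hι : 0 ≤ ι) (hH : 0 < M.H) (h' : ℕ)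
    (s' : S) (a : A) (h : ℕ) (s : S) {t : ℕ} (ht : 0 < t) :
    (runEpisodes M c L g k).toOuterMeasure {m | ∃ ys, ys <:+ nextStates h' s' a m.data ∧
        ys.length = t ∧ runAvg (rate M.H) (ys.map (relReach M (h' + 1) h · s))
          < mean (M.P h' s' a) (relReach M (h' + 1) h · s) - √(2 * M.H * ι / t)}
      ≤ ENNReal.ofReal (Real.exp (-(2 * ι))) := by
  convert toOuterMeasure_runAvg_lt_le M c L g k (rate_one M.H)
    (fun y => relReach_mem_Icc M (h' + 1) h y s) h' s' a ht (Real.sqrt_nonneg (2 * M.H * ι / t))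
    (v := 2 * M.H / t) (by positivity) (sqWeight_rate_le hH ht) using 4
  rw [Real.sq_sqrt (by positivity)]
  field_simp

theorem toOuterMeasure_not_concentrated_le (k T : ℕ) {ι : ℝ} (hι : 0 ≤ ι) :
    (runEpisodes M c L g k).toOuterMeasure
        {m | (∀ h ∈ Set.Icc 1 M.H, ∀ s a, visits h s a m.data ≤ T) ∧ ¬Concentrated M ι m.data}
      ≤ (M.H ^ 2 * Fintype.card S ^ 2 * Fintype.card A * T : ℕ)
        * ENNReal.ofReal (Real.exp (-(2 * ι))) := by
  let indices : Finset (ℕ × S × A × ℕ × S × ℕ) := Finset.Icc 1 M.H ×ˢ Finset.univ ×ˢ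
    Finset.univ ×ˢ Finset.Icc 1 M.H ×ˢ Finset.univ ×ˢ Finset.Icc 1 T
  let deviation : ℕ × S × A × ℕ × S × ℕ → Set (Memory S A) := fun (h', s', a, h, s, t) =>
    {m | ∃ ys, ys <:+ nextStates h' s' a m.data ∧ ys.length = t ∧
      runAvg (rate M.H) (ys.map (relReach M (h' + 1) h · s))
        < mean (M.P h' s' a) (relReach M (h' + 1) h · s) - √(2 * M.H * ι / t)}
  have deviation_le : ∀ i ∈ indices, (runEpisodes M c L g k).toOuterMeasure (deviation i)
      ≤ ENNReal.ofReal (Real.exp (-(2 * ι))) := by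
    rintro ⟨h', s', a, h, s, t⟩ hi
    simp only [indices, Finset.mem_product, Finset.mem_Icc] at hi
    exact toOuterMeasure_runAvg_relReach_lt_le M c L g k hι (by omega) h' s' a h s (by omega)
  calc (runEpisodes M c L g k).toOuterMeasure _
      ≤ (runEpisodes M c L g k).toOuterMeasure (⋃ i ∈ indices, deviation i) := by
        refine MeasureTheory.measure_mono fun m ⟨hT, hm⟩ => ?_
        simp only [Concentrated] at hm
        push Not at hm
        obtain ⟨h', s', a, h, s, hh', hlt, hh, ys, hys, hne, hdev⟩ := hm
        refine Set.mem_biUnion (x := (h', s', a, h, s, ys.length)) ?_ ⟨ys, hys, rfl, hdev⟩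
        have := hys.length_le.trans (hT h' ⟨hh', hlt.le.trans hh⟩ s' a)
        have := List.length_pos_iff.2 hne
        simp only [indices, Finset.mem_coe, Finset.mem_product, Finset.mem_Icc, Finset.mem_univ,
          true_and]
        omega
    _ ≤ ∑ i ∈ indices, (runEpisodes M c L g k).toOuterMeasure (deviation i) :=
        MeasureTheory.measure_biUnion_finset_le _ _
    _ ≤ ∑ _i ∈ indices, ENNReal.ofReal (Real.exp (-(2 * ι))) := Finset.sum_le_sum deviation_le
    _ = _ := by
        rw [Finset.sum_const, nsmul_eq_mul]
        simp only [indices, Finset.card_product, Nat.card_Icc, Finset.card_univ,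
          Nat.add_sub_cancel]
        congr 2
        ring

end Concentration

section Bonus

theorem bonus_nonneg {c : ℝ} (hc : 0 ≤ c) (L : ℝ) (H t : ℕ) : 0 ≤ bonus c L H t :=
  mul_nonneg hc (Real.sqrt_nonneg _)

theorem bonus_anti {c L : ℝ} (hc : 0 ≤ c) (hL : 0 ≤ L) (H : ℕ) {t t' : ℕ} (ht : 1 ≤ t)
    (htt' : t ≤ t') : bonus c L H t' ≤ bonus c L H t := by
  have : (0 : ℝ) < t := by exact_mod_cast ht
  unfold bonus
  gcongr

theorem mul_sqrt_le_two_bonus {c ι L B : ℝ} {H : ℕ} (hc : 1 ≤ c) (hL : 0 ≤ L) (hι : ι ≤ L)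
    (hB : B ≤ H) (t : ℕ) : B * √(2 * H * ι / t) ≤ 2 * bonus c L H t :=
  calc B * √(2 * H * ι / t) ≤ H * √(2 * H * L / t) := by gcongr
    _ = √(2 * (H ^ 3 * L / t)) := by
      rw [← Real.sqrt_sq (H.cast_nonneg (α := ℝ)), ← Real.sqrt_mul (sq_nonneg _),
        Real.sqrt_sq H.cast_nonneg]
      ring_nf
    _ ≤ √(2 ^ 2 * (H ^ 3 * L / t)) := by gcongr; norm_num
    _ = 2 * (1 * √(H ^ 3 * L / t)) := by
      rw [Real.sqrt_mul (by norm_num), Real.sqrt_sq (by norm_num), one_mul]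
    _ ≤ 2 * bonus c L H t := by unfold bonus; gcongr

end Bonus

section Replay

variable {S A : Type*} [Fintype A] [Nonempty A]

theorem le_vbar {H h : ℕ} (hh : h ≤ H) {m : Memory S A} {s : S} {v : ℝ} (hv : v ≤ H) (a : A)
    (hQ : v ≤ m.Q h s a) : v ≤ vbar H m h s := by
  rw [vbar, if_pos hh]
  exact le_min hv (hQ.trans (Finset.le_sup' (m.Q h s) (Finset.mem_univ a)))

theorem vbar_nonneg (H : ℕ) {m : Memory S A} (hm : ∀ h s a, 0 ≤ m.Q h s a) (h : ℕ) (s : S) :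
    0 ≤ vbar H m h s := by
  by_cases hh : h ≤ H
  · exact le_vbar hh H.cast_nonneg (Classical.arbitrary A) (hm h s _)
  · rw [vbar, if_neg hh]

theorem vbar_horizon_succ (H : ℕ) (m : Memory S A) (s : S) : vbar H m (H + 1) s = 0 :=
  if_neg (Nat.lt_irrefl H)

variable [DecidableEq S] [DecidableEq A] (H : ℕ) (c L : ℝ)

/-- The memory of UCBZero after observing the transitions in a history. -/
def replay : History S A → Memory S A
  | [] => initMemory S A H
  | (h, s, a, s') :: l => (replay l).update H c L h s a s'

theorem replay_data (l : History S A) : (replay H c L l).data = l := by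
  induction l with
  | nil => rfl
  | cons x l ih => simp only [replay, Memory.update, ih]

theorem replay_count (h : ℕ) (s : S) (a : A) (l : History S A) :
    (replay H c L l).count h s a = visits h s a l := by
  induction l generalizing h s a with
  | nil => rfl
  | cons x l ih =>
    obtain ⟨h₀, s₀, a₀, s'⟩ := x
    by_cases hvisit : h = h₀ ∧ s = s₀ ∧ a = a₀
    · obtain ⟨rfl, rfl, rfl⟩ := hvisit
      simp [replay, Memory.update, visits_cons_self, ih]
    · simp [replay, Memory.update, visits_cons_of_ne hvisit, ih, hvisit]

theorem replay_Q_cons_self (h : ℕ) (s : S) (a : A) (s' : S) (l : History S A) :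
    (replay H c L ((h, s, a, s') :: l)).Q h s a =
      (1 - rate H (visits h s a l + 1)) * (replay H c L l).Q h s a
        + rate H (visits h s a l + 1) * (vbar H (replay H c L l) (h + 1) s'
          + 2 * bonus c L H (visits h s a l + 1)) := by
  simp [replay, Memory.update, replay_count]

theorem replay_Q_cons_of_ne {h h₀ : ℕ} {s s₀ : S} {a a₀ : A}
    (hne : ¬(h = h₀ ∧ s = s₀ ∧ a = a₀)) (s' : S) (l : History S A) :
    (replay H c L ((h₀, s₀, a₀, s') :: l)).Q h s a = (replay H c L l).Q h s a := by
  simp only [replay, Memory.update, if_neg hne]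

theorem vbar_replay_cons_of_ne {h h₀ : ℕ} (hne : h ≠ h₀) (s s₀ : S) (a₀ : A) (s' : S)
    (l : History S A) :
    vbar H (replay H c L ((h₀, s₀, a₀, s') :: l)) h s = vbar H (replay H c L l) h s := by
  have Q_eq : (replay H c L ((h₀, s₀, a₀, s') :: l)).Q h s = (replay H c L l).Q h s :=
    funext fun a => replay_Q_cons_of_ne H c L (fun h => hne h.1) s' l
  rw [vbar, vbar, Q_eq]

variable {c L}

theorem replay_Q_nonneg (hc : 0 ≤ c) (l : History S A) (h : ℕ) (s : S) (a : A) :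
    0 ≤ (replay H c L l).Q h s a := by
  induction l generalizing h s a with
  | nil => exact H.cast_nonneg
  | cons x l ih =>
    obtain ⟨h₀, s₀, a₀, s'⟩ := x
    by_cases hvisit : h = h₀ ∧ s = s₀ ∧ a = a₀
    · obtain ⟨rfl, rfl, rfl⟩ := hvisit
      rw [replay_Q_cons_self]
      have := one_sub_rate_succ_nonneg H (visits h s a l)
      have := rate_nonneg H (visits h s a l + 1)
      have := vbar_nonneg H ih (h + 1) s'
      have := bonus_nonneg hc L H (visits h s a l + 1)
      have := ih h s a
      positivity
    · rw [replay_Q_cons_of_ne H c L hvisit]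
      exact ih h s a

theorem replay_Q_of_visits_eq_zero {h : ℕ} {s : S} {a : A} {l : History S A}
    (hl : visits h s a l = 0) : (replay H c L l).Q h s a = H := by
  induction l with
  | nil => rfl
  | cons x l ih =>
    obtain ⟨h₀, s₀, a₀, s'⟩ := x
    by_cases hvisit : h = h₀ ∧ s = s₀ ∧ a = a₀
    · obtain ⟨rfl, rfl, rfl⟩ := hvisit
      simp [visits_cons_self] at hl
    · rw [replay_Q_cons_of_ne H c L hvisit, ih (by rwa [visits_cons_of_ne hvisit] at hl)]

theorem runAvg_add_two_bonus_le_replay_Q (hc : 0 ≤ c) (hL : 0 ≤ L) {h : ℕ} {s : S} {a : A}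
    {l : History S A} {u : S → ℝ}
    (hu : ∀ l', l' <:+ l → ∀ y, u y ≤ vbar H (replay H c L l') (h + 1) y)
    (hl : 1 ≤ visits h s a l) :
    runAvg (rate H) ((nextStates h s a l).map u) + 2 * bonus c L H (visits h s a l)
      ≤ (replay H c L l).Q h s a := by
  induction l with
  | nil => simp [visits_nil] at hl
  | cons x l ih =>
    obtain ⟨h₀, s₀, a₀, s'⟩ := x
    have hu' : ∀ l', l' <:+ l → ∀ y, u y ≤ vbar H (replay H c L l') (h + 1) y :=
      fun l' hl' => hu l' (hl'.trans (List.suffix_cons _ _))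
    by_cases hvisit : h = h₀ ∧ s = s₀ ∧ a = a₀
    · obtain ⟨rfl, rfl, rfl⟩ := hvisit
      rw [replay_Q_cons_self, nextStates_cons_self, visits_cons_self, List.map_cons, runAvg,
        List.length_map, ← visits]
      set n := visits h s a l
      have old : (1 - rate H (n + 1)) * (runAvg (rate H) ((nextStates h s a l).map u)
            + 2 * bonus c L H (n + 1)) ≤ (1 - rate H (n + 1)) * (replay H c L l).Q h s a := by
        rcases Nat.eq_zero_or_pos n with hn | hn
        · simp [hn, rate_one]
        · refine mul_le_mul_of_nonneg_left (le_trans ?_ (ih hu' hn))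
            (one_sub_rate_succ_nonneg H n)
          gcongr
          exact bonus_anti hc hL H hn n.le_succ
      have new : rate H (n + 1) * (u s' + 2 * bonus c L H (n + 1))
          ≤ rate H (n + 1) * (vbar H (replay H c L l) (h + 1) s' + 2 * bonus c L H (n + 1)) := by
        gcongr
        exacts [rate_nonneg H _, hu' l List.suffix_rfl s']
      linarith
    · rw [visits_cons_of_ne hvisit] at hl ⊢
      rw [replay_Q_cons_of_ne H c L hvisit, nextStates_cons_of_ne hvisit]
      exact ih hu' hl

theorem two_bonus_le_replay_Q (hc : 0 ≤ c) (hL : 0 ≤ L) {h : ℕ} {s : S} {a : A}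
    {l : History S A} (hl : 1 ≤ visits h s a l) :
    2 * bonus c L H (visits h s a l) ≤ (replay H c L l).Q h s a := by
  have h := runAvg_add_two_bonus_le_replay_Q H hc hL (u := fun _ => 0)
    (fun l' _ => vbar_nonneg H (replay_Q_nonneg H hc l') _) hl
  rwa [runAvg_map_zero, zero_add] at h

end Replay

section Optimism

variable {S A : Type*} [Fintype S] [DecidableEq S] [Fintype A] [DecidableEq A] [Nonempty A]
  {M : EpisodicMDP S A} {c ι L B : ℝ} {l : History S A}

theorem mul_mean_relReach_le_replay_Q (hc : 1 ≤ c) (hL : 0 ≤ L) (hι : ι ≤ L)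
    (hconc : Concentrated M ι l) (hB : 0 ≤ B) (hBH : B ≤ M.H) {h' h : ℕ} (hh' : 1 ≤ h')
    (hlt : h' < h) (hh : h ≤ M.H) {s : S} {l' : History S A} (hl' : l' <:+ l)
    (hnext : ∀ l'', l'' <:+ l' → ∀ y,
      B * relReach M (h' + 1) h y s ≤ vbar M.H (replay M.H c L l'') (h' + 1) y)
    (s' : S) (a : A) :
    B * mean (M.P h' s' a) (relReach M (h' + 1) h · s) ≤ (replay M.H c L l').Q h' s' a := by
  rcases Nat.eq_zero_or_pos (visits h' s' a l') with hn | hn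
  · rw [replay_Q_of_visits_eq_zero M.H hn]
    exact (mul_le_of_le_one_right hB (mean_relReach_le_one M _ (h' + 1) h s)).trans hBH
  · have deviation := hconc h' s' a h s hh' hlt hh (nextStates h' s' a l')
      (nextStates_suffix_of_suffix h' s' a hl') (List.length_pos_iff.1 hn)
    rw [← visits] at deviation
    have backup := runAvg_add_two_bonus_le_replay_Q M.H (by linarith) hL hnext hn
    rw [runAvg_map_const_mul] at backup
    linarith [mul_le_mul_of_nonneg_left deviation hB,
      mul_sqrt_le_two_bonus hc hL hι hBH (visits h' s' a l')]

theorem mul_relReach_le_vbar (hc : 1 ≤ c) (hL : 0 ≤ L) (hι : ι ≤ L) (hconc : Concentrated M ι l)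
    (hB : 0 < B) (hBH : B ≤ M.H) {h : ℕ} (hh : h ≤ M.H) {s : S} {a : A}
    (hbonus : ∀ t, 1 ≤ t → t ≤ visits h s a l → B ≤ 2 * bonus c L M.H t) {h' : ℕ} (hh' : 1 ≤ h')
    (hh'h : h' ≤ h) (s' : S) {l' : History S A} (hl' : l' <:+ l) :
    B * relReach M h' h s' s ≤ vbar M.H (replay M.H c L l') h' s' := by
  have hc₀ : 0 ≤ c := by linarith
  induction hh'h using Nat.decreasingInduction generalizing s' l' with
  | self =>
    rcases eq_or_ne s' s with rfl | hne
    · refine (mul_le_of_le_one_right hB.le (relReach_le_one M h h s' s')).trans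
        (le_vbar hh hBH a ?_)
      rcases Nat.eq_zero_or_pos (visits h s' a l') with hn | hn
      · rwa [replay_Q_of_visits_eq_zero M.H hn]
      · exact (hbonus _ hn (visits_le_of_suffix h s' a hl')).trans
          (two_bonus_le_replay_Q M.H hc₀ hL hn)
    · rw [relReach_self_of_ne M hne, mul_zero]
      exact vbar_nonneg M.H (replay_Q_nonneg M.H hc₀ l') h s'
  | of_succ h' hlt ih =>
    have hh'H : h' ≤ M.H := (Nat.le_of_succ_le hlt).trans hh
    rw [← le_div_iff₀' hB]
    refine relReach_le_of_forall_mean_le M hlt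
      (div_nonneg (vbar_nonneg M.H (replay_Q_nonneg M.H hc₀ l') h' s') hB.le) fun a' => ?_
    rw [le_div_iff₀' hB]
    refine le_vbar hh'H ?_ a' ?_
    · exact (mul_le_of_le_one_right hB.le (mean_relReach_le_one M _ (h' + 1) h s)).trans hBH
    · exact mul_mean_relReach_le_replay_Q hc hL hι hconc hB.le hBH hh' hlt hh hl'
        (fun l'' hl'' y => ih (by omega) y (hl''.trans hl')) s' a'

end Optimism

section SumAt

variable {S A : Type*}

/-- The sum of `F l s a s'` over the transitions from `s` to `s'` under `a` at step `h`, where `l`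
is the history before the transition. -/
def sumAt (h : ℕ) (F : History S A → S → A → S → ℝ) : History S A → ℝ
  | [] => 0
  | (h₀, s, a, s') :: l => (if h₀ = h then F l s a s' else 0) + sumAt h F l

theorem sumAt_cons_self (h : ℕ) (F : History S A → S → A → S → ℝ) (s : S) (a : A) (s' : S)
    (l : History S A) : sumAt h F ((h, s, a, s') :: l) = F l s a s' + sumAt h F l := by
  rw [sumAt, if_pos rfl]

theorem sumAt_cons_of_ne {h h₀ : ℕ} (hne : h₀ ≠ h) (F : History S A → S → A → S → ℝ) (s : S)
    (a : A) (s' : S) (l : History S A) : sumAt h F ((h₀, s, a, s') :: l) = sumAt h F l := by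
  rw [sumAt, if_neg hne, zero_add]

theorem sumAt_mono (h : ℕ) {F G : History S A → S → A → S → ℝ}
    (hFG : ∀ l s a s', F l s a s' ≤ G l s a s') (l : History S A) : sumAt h F l ≤ sumAt h G l := by
  induction l with
  | nil => exact le_rfl
  | cons x l ih =>
    rw [sumAt, sumAt]
    gcongr
    split_ifs
    exacts [hFG _ _ _ _, le_rfl]

theorem sumAt_add (h : ℕ) (F G : History S A → S → A → S → ℝ) (l : History S A) :
    sumAt h (fun l s a s' => F l s a s' + G l s a s') l = sumAt h F l + sumAt h G l := by
  induction l with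
  | nil => simp [sumAt]
  | cons x l ih =>
    rw [sumAt, sumAt, sumAt, ih]
    split_ifs <;> ring

theorem sumAt_const_mul (h : ℕ) (r : ℝ) (F : History S A → S → A → S → ℝ) (l : History S A) :
    sumAt h (fun l s a s' => r * F l s a s') l = r * sumAt h F l := by
  induction l with
  | nil => simp [sumAt]
  | cons x l ih =>
    rw [sumAt, sumAt, ih]
    split_ifs <;> ring

variable [Fintype S] [Fintype A]

theorem sum_eq_sum_nil_add_sumAt (h : ℕ) {φ : History S A → S → A → ℝ}
    (hφ : ∀ h₀ s₀ a₀ s' l s a, ¬(h = h₀ ∧ s = s₀ ∧ a = a₀) →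
      φ ((h₀, s₀, a₀, s') :: l) s a = φ l s a) (l : History S A) :
    ∑ x : S × A, φ l x.1 x.2 = ∑ x : S × A, φ [] x.1 x.2
      + sumAt h (fun l s a s' => φ ((h, s, a, s') :: l) s a - φ l s a) l := by
  induction l with
  | nil => simp [sumAt]
  | cons x l ih =>
    obtain ⟨h₀, s₀, a₀, s'⟩ := x
    rw [sumAt, add_left_comm, ← ih, ← sub_eq_iff_eq_add, ← Finset.sum_sub_distrib]
    by_cases hh : h₀ = h
    · subst hh
      rw [if_pos rfl]
      refine Finset.sum_eq_single_of_mem (s₀, a₀) (Finset.mem_univ _) fun x _ hx => ?_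
      rw [hφ, sub_self]
      exact fun h => hx (Prod.ext h.2.1 h.2.2)
    · rw [if_neg hh]
      exact Finset.sum_eq_zero fun x _ => by rw [hφ _ _ _ _ _ _ _ fun h => hh h.1.symm, sub_self]

variable [DecidableEq S] [DecidableEq A]

theorem sum_visits_eq_sumAt (h : ℕ) (l : History S A) :
    ∑ x : S × A, (visits h x.1 x.2 l : ℝ) = sumAt h (fun _ _ _ _ => 1) l := by
  rw [sum_eq_sum_nil_add_sumAt h (φ := fun l s a => (visits h s a l : ℝ))]
  · simp [visits_nil, visits_cons_self]
  · intro h₀ s₀ a₀ s' l s a hne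
    rw [visits_cons_of_ne hne]

theorem inv_sqrt_succ_le (n : ℕ) : (√((n + 1 : ℕ) : ℝ))⁻¹ ≤ 2 * (√((n + 1 : ℕ) : ℝ) - √n) := by
  have hpos : 0 < √((n + 1 : ℕ) : ℝ) := Real.sqrt_pos.2 (by positivity)
  rw [inv_le_iff_one_le_mul₀ hpos]
  have := Real.sq_sqrt (n.cast_nonneg (α := ℝ))
  have := Real.sq_sqrt ((n + 1).cast_nonneg (α := ℝ))
  push_cast at *
  nlinarith [sq_nonneg (√((n : ℝ) + 1) - √n)]

theorem sumAt_bonus_le {c : ℝ} (hc : 0 ≤ c) (L : ℝ) (H h : ℕ) (l : History S A) :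
    sumAt h (fun l s a _ => bonus c L H (visits h s a l + 1)) l
      ≤ 2 * bonus c L H 1 * ∑ x : S × A, √(visits h x.1 x.2 l : ℝ) := by
  rw [Finset.mul_sum, sum_eq_sum_nil_add_sumAt h
    (φ := fun l s a => 2 * bonus c L H 1 * √(visits h s a l : ℝ))]
  · simp only [visits_nil, Nat.cast_zero, Real.sqrt_zero, mul_zero, Finset.sum_const_zero, zero_add,
      visits_cons_self]
    refine sumAt_mono h (fun l s a _ => ?_) l
    calc bonus c L H (visits h s a l + 1)
        = bonus c L H 1 * (√((visits h s a l + 1 : ℕ) : ℝ))⁻¹ := by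
          rw [bonus, bonus, Nat.cast_one, div_one, Real.sqrt_div' _ (Nat.cast_nonneg _),
            div_eq_mul_inv, mul_assoc]
      _ ≤ bonus c L H 1 * (2 * (√((visits h s a l + 1 : ℕ) : ℝ) - √(visits h s a l : ℝ))) := by
          gcongr
          exacts [bonus_nonneg hc L H 1, inv_sqrt_succ_le _]
      _ = _ := by ring
  · intro h₀ s₀ a₀ s' l s a hne
    rw [visits_cons_of_ne hne]

theorem sum_sqrt_visits_le (h : ℕ) (l : History S A) :
    ∑ x : S × A, √(visits h x.1 x.2 l : ℝ)
      ≤ √(Fintype.card S * Fintype.card A * sumAt h (fun _ _ _ _ => 1) l) := by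
  refine Real.le_sqrt_of_sq_le (sq_sum_le_card_mul_sum_sq.trans_eq ?_)
  simp_rw [Real.sq_sqrt (Nat.cast_nonneg _), sum_visits_eq_sumAt, Finset.card_univ,
    Fintype.card_prod, Nat.cast_mul]

/-- The sum of `(1 + N_h(s,a) / H) Q_h(s,a)` over all `s` and `a` telescopes because
`(H + t) / H * α_t = 1 + 1 / H`. -/
theorem sumAt_replay_Q_le [Nonempty A] {c : ℝ} (hc : 0 ≤ c) (L : ℝ) {H : ℕ} (hH : 1 ≤ H) (h : ℕ)
    (l : History S A) :
    sumAt h (fun l s a _ => (replay H c L l).Q h s a) l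
      ≤ Fintype.card S * Fintype.card A * H + (1 + 1 / H)
        * (sumAt h (fun l _ _ s' => vbar H (replay H c L l) (h + 1) s') l
          + 2 * sumAt h (fun l s a _ => bonus c L H (visits h s a l + 1)) l) := by
  have : (0 : ℝ) < H := by exact_mod_cast hH
  have potential := sum_eq_sum_nil_add_sumAt h
    (φ := fun l s a => (1 + visits h s a l / H) * (replay H c L l).Q h s a)
    (fun h₀ s₀ a₀ s' l s a hne => by rw [visits_cons_of_ne hne, replay_Q_cons_of_ne H c L hne]) l
  have increment : ∀ (l : History S A) s a s',
      (1 + visits h s a ((h, s, a, s') :: l) / H) * (replay H c L ((h, s, a, s') :: l)).Q h s a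
          - (1 + visits h s a l / H) * (replay H c L l).Q h s a
        = (1 + 1 / H) * (vbar H (replay H c L l) (h + 1) s'
            + 2 * bonus c L H (visits h s a l + 1)) + -1 * (replay H c L l).Q h s a := by
    intro l s a s'
    rw [replay_Q_cons_self, one_sub_rate_succ, rate, visits_cons_self]
    push_cast
    field_simp
    ring
  simp_rw [increment, sumAt_add, sumAt_const_mul, sumAt_add, sumAt_const_mul] at potential
  have initial : ∑ x : S × A, (1 + (visits h x.1 x.2 [] : ℝ) / H) * (replay H c L []).Q h x.1 x.2
      = Fintype.card S * Fintype.card A * H := by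
    simp [visits_nil, replay, initMemory]
  have final_nonneg : 0 ≤ ∑ x : S × A, (1 + (visits h x.1 x.2 l : ℝ) / H)
      * (replay H c L l).Q h x.1 x.2 :=
    Finset.sum_nonneg fun x _ => mul_nonneg (by positivity) (replay_Q_nonneg H hc l h x.1 x.2)
  linarith

end SumAt

section Run

variable {S A : Type*} [DecidableEq S] [DecidableEq A] [Fintype A] [Nonempty A]

/-- `IsRun M c L k h s l` means that `l` is a possible history of UCBZero on `M` at the moment when
`k` episodes are complete and the learner is in state `s` at step `h` of the next one. -/
inductive IsRun (M : EpisodicMDP S A) (c L : ℝ) : ℕ → ℕ → S → History S A → Prop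
  | nil : IsRun M c L 0 1 M.s₁ []
  | step {k h : ℕ} {s : S} {l : History S A} (run : IsRun M c L k h s l) (le_horizon : h ≤ M.H)
      {a : A} (greedy : ∀ b, (replay M.H c L l).Q h s b ≤ (replay M.H c L l).Q h s a) (s' : S) :
      IsRun M c L k (h + 1) s' ((h, s, a, s') :: l)
  | next {k : ℕ} {s : S} {l : History S A} (run : IsRun M c L k (M.H + 1) s l) :
      IsRun M c L (k + 1) 1 M.s₁ l

variable {M : EpisodicMDP S A} {c L : ℝ}

theorem exists_isRun_of_mem_support_runSteps {g : ActionRule S A} (hg : IsGreedy g) {k n h : ℕ}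
    {s : S} {l : History S A} (hrun : IsRun M c L k h s l) (hn : h + n = M.H + 1) {m : Memory S A}
    (hm : m ∈ (runSteps M c L g n h s (replay M.H c L l)).support) :
    ∃ s' l', m = replay M.H c L l' ∧ IsRun M c L k (M.H + 1) s' l' := by
  induction n generalizing h s l with
  | zero =>
    obtain rfl : h = M.H + 1 := hn
    rw [runSteps, PMF.mem_support_pure_iff] at hm
    exact ⟨s, l, hm, hrun⟩
  | succ n ih =>
    simp only [runSteps, PMF.mem_support_bind_iff] at hm
    obtain ⟨a, ha, s', -, hm⟩ := hm
    exact ih (hrun.step (by omega) (hg _ h s a ha) s') (by omega) hm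

theorem exists_isRun_of_mem_support_runEpisodes {g : ActionRule S A} (hg : IsGreedy g) {k : ℕ}
    {m : Memory S A} (hm : m ∈ (runEpisodes M c L g k).support) :
    ∃ l, m = replay M.H c L l ∧ IsRun M c L k 1 M.s₁ l := by
  induction k generalizing m with
  | zero =>
    rw [runEpisodes, PMF.mem_support_pure_iff] at hm
    exact ⟨[], hm, .nil⟩
  | succ k ih =>
    rw [runEpisodes, PMF.mem_support_bind_iff] at hm
    obtain ⟨m', hm', hm⟩ := hm
    obtain ⟨l', rfl, hrun'⟩ := ih hm'
    obtain ⟨s, l, rfl, hrun⟩ := exists_isRun_of_mem_support_runSteps hg hrun' (add_comm _ _) hm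
    exact ⟨l, rfl, hrun.next⟩

namespace IsRun

variable {k h : ℕ} {s : S} {l : History S A}

theorem one_le (hrun : IsRun M c L k h s l) : 1 ≤ h := by
  cases hrun with
  | nil => exact le_rfl
  | step => omega
  | next => exact le_rfl

theorem eq_start (hrun : IsRun M c L k h s l) (hh : h = 1) : s = M.s₁ := by
  cases hrun with
  | nil => rfl
  | step run => have := run.one_le; omega
  | next => rfl

theorem sumAt_one (hrun : IsRun M c L k h s l) {i : ℕ} (hi : i ∈ Set.Icc 1 M.H) :
    sumAt i (fun _ _ _ _ => 1) l = k + if i < h then 1 else 0 := by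
  obtain ⟨one_le_i, i_le⟩ := hi
  induction hrun with
  | nil => rw [if_neg (show ¬i < 1 by omega)]; simp [sumAt]
  | @step k h s l _ _ a _ s' ih =>
    rcases eq_or_ne h i with rfl | hne
    · rw [sumAt_cons_self, ih, if_neg (lt_irrefl h), if_pos h.lt_succ_self]
      ring
    · rw [sumAt_cons_of_ne hne, ih]
      congr 2
      exact propext (by omega)
  | next _ ih =>
    rw [ih, if_pos (by omega), if_neg (by omega)]
    simp

/-- Greedy actions attain the maximum in the definition of `vbar`. -/
theorem sumAt_vbar_le_sumAt_Q (hrun : IsRun M c L k h s l) (i : ℕ) :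
    sumAt i (fun l s _ _ => vbar M.H (replay M.H c L l) i s) l
      ≤ sumAt i (fun l s a _ => (replay M.H c L l).Q i s a) l := by
  induction hrun with
  | nil => exact le_rfl
  | @step _ h s l _ le_horizon a greedy s' ih =>
    rcases eq_or_ne h i with rfl | hne
    · rw [sumAt_cons_self, sumAt_cons_self, vbar, if_pos le_horizon]
      gcongr
      exact (min_le_right _ _).trans (Finset.sup'_le _ _ fun b _ => greedy b)
    · rwa [sumAt_cons_of_ne hne, sumAt_cons_of_ne hne]
  | next _ ih => exact ih

theorem sumAt_vbar_succ (hrun : IsRun M c L k h s l) {i : ℕ} (hi : 1 ≤ i) :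
    sumAt i (fun l _ _ s' => vbar M.H (replay M.H c L l) (i + 1) s') l
      = sumAt (i + 1) (fun l s _ _ => vbar M.H (replay M.H c L l) (i + 1) s) l
        + if i + 1 = h then vbar M.H (replay M.H c L l) (i + 1) s else 0 := by
  induction hrun with
  | nil => rw [if_neg (show i + 1 ≠ 1 by omega)]; simp [sumAt]
  | @step k h s l run _ a _ s' ih =>
    rcases eq_or_ne h i with rfl | hne
    · rw [sumAt_cons_self, sumAt_cons_of_ne h.succ_ne_self.symm, ih, if_pos rfl,
        if_neg h.succ_ne_self, vbar_replay_cons_of_ne M.H c L h.succ_ne_self]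
      ring
    · rw [sumAt_cons_of_ne hne, ih, if_neg (show i + 1 ≠ h + 1 by omega), sumAt]
      rcases eq_or_ne h (i + 1) with rfl | hne'
      · simp [add_comm]
      · simp [hne', hne'.symm]
  | @next _ s l _ ih =>
    rw [ih, if_neg (show i + 1 ≠ 1 by omega)]
    split_ifs with hi'
    · rw [hi', vbar_horizon_succ]
    · rfl

theorem mul_le_sumAt_vbar (hrun : IsRun M c L k h s l) {v : ℝ}
    (hv : ∀ l', l' <:+ l → v ≤ vbar M.H (replay M.H c L l') 1 M.s₁) :
    v * sumAt 1 (fun _ _ _ _ => 1) l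
      ≤ sumAt 1 (fun l s _ _ => vbar M.H (replay M.H c L l) 1 s) l := by
  induction hrun with
  | nil => simp [sumAt]
  | @step k h s l run _ a _ s' ih =>
    have ih := ih fun l' hl' => hv l' (hl'.trans (List.suffix_cons _ _))
    rcases eq_or_ne h 1 with rfl | hne
    · rw [sumAt_cons_self, sumAt_cons_self, mul_add, mul_one, run.eq_start rfl]
      exact add_le_add (hv l (List.suffix_cons _ _)) ih
    · rwa [sumAt_cons_of_ne hne, sumAt_cons_of_ne hne]
  | next _ ih => exact ih hv

theorem sum_visits [Fintype S] (hrun : IsRun M c L k 1 s l) {i : ℕ} (hi : i ∈ Set.Icc 1 M.H) :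
    ∑ y : S × A, visits i y.1 y.2 l = k := by
  have total := hrun.sumAt_one hi
  rw [← sum_visits_eq_sumAt, if_neg hi.1.not_gt, add_zero] at total
  exact_mod_cast total

theorem visits_le [Finite S] (hrun : IsRun M c L k 1 s l) {i : ℕ} (hi : i ∈ Set.Icc 1 M.H) (x : S)
    (a : A) : visits i x a l ≤ k := by
  have := Fintype.ofFinite S
  exact (Finset.single_le_sum (f := fun y : S × A => visits i y.1 y.2 l)
    (fun _ _ => Nat.zero_le _) (Finset.mem_univ (x, a))).trans_eq (hrun.sum_visits hi)

theorem visits_eq_of_subsingleton [Subsingleton S] [Subsingleton A] (hrun : IsRun M c L k 1 s l)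
    {i : ℕ} (hi : i ∈ Set.Icc 1 M.H) (x : S) (a : A) : visits i x a l = k := by
  have := Fintype.ofFinite S
  rw [← hrun.sum_visits hi, Fintype.sum_subsingleton _ (x, a)]

end IsRun

end Run

section Value

theorem le_of_backward_recursion {u : ℕ → ℝ} {X r : ℝ} (hX : 0 ≤ X) (hr : 1 ≤ r) {H : ℕ}
    (hlast : u H = 0) (hstep : ∀ i < H, u i ≤ X + r * u (i + 1)) : u 0 ≤ H * X * r ^ H := by
  induction H generalizing u with
  | zero => simp [hlast]
  | succ H ih =>
    have tail : u 1 ≤ H * X * r ^ H :=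
      ih (u := fun i => u (i + 1)) hlast fun i hi => hstep (i + 1) (by omega)
    calc u 0 ≤ X + r * u 1 := hstep 0 H.succ_pos
      _ ≤ X * r ^ (H + 1) + r * (H * X * r ^ H) :=
        add_le_add (le_mul_of_one_le_right hX (one_le_pow₀ hr)) (by gcongr)
      _ = (H + 1 : ℕ) * X * r ^ (H + 1) := by push_cast; ring

theorem one_add_one_div_pow_le_three (H : ℕ) : (1 + 1 / (H : ℝ)) ^ H ≤ 3 := by
  rw [one_div]
  exact Real.one_add_inv_pow_le_exp.trans Real.exp_one_lt_three.le

namespace IsRun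

variable {S A : Type*} [Fintype S] [DecidableEq S] [Fintype A] [DecidableEq A] [Nonempty A]
  {M : EpisodicMDP S A} {c L : ℝ} {k : ℕ} {s : S} {l : History S A}

theorem sumAt_vbar_le (hrun : IsRun M c L k 1 s l) (hc : 0 ≤ c) {h : ℕ} (hh : h ∈ Set.Icc 1 M.H) :
    sumAt h (fun l s _ _ => vbar M.H (replay M.H c L l) h s) l
      ≤ Fintype.card S * Fintype.card A * M.H
          + 8 * bonus c L M.H 1 * √(Fintype.card S * Fintype.card A * k)
        + (1 + 1 / M.H)
          * sumAt (h + 1) (fun l s _ _ => vbar M.H (replay M.H c L l) (h + 1) s) l := by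
  obtain ⟨one_le_h, h_le⟩ := hh
  have count := hrun.sumAt_one ⟨one_le_h, h_le⟩
  rw [if_neg (by omega), add_zero] at count
  have next := hrun.sumAt_vbar_succ one_le_h
  rw [if_neg (by omega), add_zero] at next
  have telescoped := sumAt_replay_Q_le hc L (one_le_h.trans h_le) h l
  rw [next] at telescoped
  have b_nonneg := bonus_nonneg hc L M.H 1
  set X := √(Fintype.card S * Fintype.card A * k : ℝ)
  have bonuses : sumAt h (fun l s a _ => bonus c L M.H (visits h s a l + 1)) l
      ≤ 2 * bonus c L M.H 1 * X := by
    refine (sumAt_bonus_le hc L M.H h l).trans ?_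
    gcongr
    exact (sum_sqrt_visits_le h l).trans_eq (by rw [count])
  have factor_le : (1 + 1 / (M.H : ℝ)) ≤ 2 := by
    have : (1 : ℝ) / M.H ≤ 1 := (div_le_one₀ (by exact_mod_cast one_le_h.trans h_le)).2
      (by exact_mod_cast one_le_h.trans h_le)
    linarith
  have weighted : (1 + 1 / (M.H : ℝ))
      * (2 * sumAt h (fun l s a _ => bonus c L M.H (visits h s a l + 1)) l)
      ≤ 2 * (2 * (2 * bonus c L M.H 1 * X)) :=
    (mul_le_mul_of_nonneg_left (by gcongr) (by positivity)).trans
      (mul_le_mul_of_nonneg_right factor_le (by positivity))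
  linarith [hrun.sumAt_vbar_le_sumAt_Q h]

theorem sumAt_vbar_one_le (hrun : IsRun M c L k 1 s l) (hc : 0 ≤ c) :
    sumAt 1 (fun l s _ _ => vbar M.H (replay M.H c L l) 1 s) l
      ≤ 3 * M.H * (Fintype.card S * Fintype.card A * M.H
          + 8 * bonus c L M.H 1 * √(Fintype.card S * Fintype.card A * k)) := by
  have last : sumAt (M.H + 1) (fun l s _ _ => vbar M.H (replay M.H c L l) (M.H + 1) s) l = 0 := by
    simp_rw [vbar_horizon_succ]
    simpa using sumAt_const_mul (M.H + 1) 0 (fun _ _ _ _ => 0) l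
  have b_nonneg := bonus_nonneg hc L M.H 1
  refine (le_of_backward_recursion
    (u := fun i => sumAt (i + 1) (fun l s _ _ => vbar M.H (replay M.H c L l) (i + 1) s) l)
    (by positivity) (le_add_of_nonneg_right (by positivity)) last fun i hi =>
    hrun.sumAt_vbar_le hc ⟨by omega, by omega⟩).trans ?_
  rw [mul_comm _ (_ ^ M.H), mul_assoc 3]
  gcongr
  exact one_add_one_div_pow_le_three M.H

end IsRun

end Value

section Count

theorem three_mul_le_mul_sqrt {H W K L : ℝ} (hH : 0 ≤ H) (hW : 0 ≤ W)
    (hL : 0 ≤ L) (hWK : W ≤ H * K * L) :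
    3 * H * (W * H + 8 * √(H ^ 3 * L) * √(W * K)) ≤ 27 * √(H ^ 5 * W * K * L) := by
  have explore : W * H ^ 2 ≤ √(H ^ 5 * W * K * L) := by
    refine Real.le_sqrt_of_sq_le ?_
    calc (W * H ^ 2) ^ 2 = W * H ^ 4 * W := by ring
      _ ≤ W * H ^ 4 * (H * K * L) := by gcongr
      _ = H ^ 5 * W * K * L := by ring
  have bonuses : H * (√(H ^ 3 * L) * √(W * K)) = √(H ^ 5 * W * K * L) := by
    rw [← Real.sqrt_mul (by positivity), ← Real.sqrt_sq hH, ← Real.sqrt_mul (sq_nonneg _),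
      Real.sqrt_sq hH]
    ring_nf
  linarith

theorem sqrt_div_le_two_mul_bonus {W L X : ℝ} {H t : ℕ} (hL : 0 ≤ L) (hX : 0 < X) (ht : 0 < t)
    (htX : t * (H ^ 2 * W * 200) ≤ X) : √(800 * (H ^ 5 * W * L) / X) ≤ 2 * bonus 1 L H t := by
  rw [bonus, one_mul, ← Real.sqrt_sq (zero_le_two (α := ℝ)), ← Real.sqrt_mul (sq_nonneg _)]
  refine Real.sqrt_le_sqrt ?_
  rw [mul_div_assoc', div_le_div_iff₀ hX (Nat.cast_pos.2 ht)]
  calc 800 * (H ^ 5 * W * L) * t = 2 ^ 2 * (H ^ 3 * L) * (t * (H ^ 2 * W * 200)) := by ring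
    _ ≤ 2 ^ 2 * (H ^ 3 * L) * X := by gcongr

namespace IsRun

variable {S A : Type*} [Fintype S] [DecidableEq S] [Fintype A] [DecidableEq A] [Nonempty A]
  {M : EpisodicMDP S A} {ι L : ℝ} {K : ℕ} {l : History S A}

theorem mul_sq_mul_reach_le (hrun : IsRun M 1 L K 1 M.s₁ l) (hconc : Concentrated M ι l)
    (hι : ι ≤ L) (hL : 0 ≤ L) (hWK : Fintype.card S * Fintype.card A ≤ M.H * K * L) {h : ℕ}
    (hh : h ∈ Set.Icc 1 M.H) {s : S} {a : A} {B : ℝ} (hB : 0 < B) (hBH : B ≤ M.H)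
    (hbonus : ∀ t, 1 ≤ t → t ≤ visits h s a l → B ≤ 2 * bonus 1 L M.H t) :
    K * (B * reach M h s) ^ 2 ≤ 729 * (M.H ^ 5 * (Fintype.card S * Fintype.card A) * L) := by
  set W : ℝ := Fintype.card S * Fintype.card A
  have optimism := hrun.mul_le_sumAt_vbar fun l' hl' =>
    mul_relReach_le_vbar le_rfl hL hι hconc hB hBH hh.2 hbonus le_rfl hh.1 M.s₁ hl'
  rw [hrun.sumAt_one ⟨le_rfl, hh.1.trans hh.2⟩, if_neg (lt_irrefl 1), add_zero] at optimism
  have value : B * reach M h s * K ≤ 27 * √(M.H ^ 5 * W * K * L) := by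
    refine optimism.trans ((hrun.sumAt_vbar_one_le zero_le_one).trans ?_)
    rw [bonus, one_mul, Nat.cast_one, div_one]
    exact three_mul_le_mul_sqrt (by positivity) (by positivity) hL hWK
  rcases K.eq_zero_or_pos with rfl | hK
  · simp only [Nat.cast_zero, zero_mul]
    positivity
  · have squared : (B * reach M h s * K) ^ 2 ≤ (27 * √(M.H ^ 5 * W * K * L)) ^ 2 :=
      pow_le_pow_left₀ (mul_nonneg (mul_nonneg hB.le (relReach_nonneg M 1 h _ s)) K.cast_nonneg)
        value 2
    rw [mul_pow 27, Real.sq_sqrt (by positivity)] at squared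
    refine le_of_mul_le_mul_right ?_ (Nat.cast_pos.2 hK : (0 : ℝ) < K)
    linarith

theorem mul_reach_sq_div_le_visits_of_half_le (hrun : IsRun M 1 L K 1 M.s₁ l)
    (hconc : Concentrated M ι l) (hι : ι ≤ L) (hL : 1 / 2 ≤ L) {h : ℕ} (hh : h ∈ Set.Icc 1 M.H)
    (s : S) (a : A)
    (hK : 800 * (M.H ^ 3 * (Fintype.card S * Fintype.card A) * L) ≤ K * reach M h s ^ 2) :
    1 / 200 * (K * reach M h s ^ 2 / (M.H ^ 2 * (Fintype.card S * Fintype.card A)))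
      ≤ visits h s a l := by
  have one_le_H : (1 : ℝ) ≤ M.H := by exact_mod_cast hh.1.trans hh.2
  have : Nonempty S := ⟨s⟩
  have W_pos : (0 : ℝ) < Fintype.card S * Fintype.card A := by
    exact_mod_cast Nat.mul_pos Fintype.card_pos Fintype.card_pos
  set W : ℝ := Fintype.card S * Fintype.card A
  set H : ℝ := (M.H : ℝ)
  set Kδ := K * reach M h s ^ 2 with Kδ_def
  have Kδ_pos : 0 < Kδ := lt_of_lt_of_le (by positivity) hK
  have Kδ_le : Kδ ≤ K := mul_le_of_le_one_right K.cast_nonneg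
    (pow_le_one₀ (relReach_nonneg M 1 h _ s) (relReach_le_one M 1 h _ s))
  have hWK : W ≤ H * K * L := by
    calc W ≤ 800 * H ^ 4 * (L * L) * W := by
          refine le_mul_of_one_le_left W_pos.le ?_
          nlinarith [one_le_pow₀ (n := 4) one_le_H, mul_self_le_mul_self (by norm_num) hL]
      _ = H * (800 * (H ^ 3 * W * L)) * L := by ring
      _ ≤ H * K * L := by gcongr; exact hK.trans Kδ_le
  by_contra! hlt
  -- Optimism with reward `B = √(800 H⁵ W L / (K δ²))` now contradicts the bound on the values.
  rw [one_div_mul_eq_div, div_div, lt_div_iff₀ (by positivity)] at hlt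
  have B_sq : √(800 * (H ^ 5 * W * L) / Kδ) ^ 2 = 800 * (H ^ 5 * W * L) / Kδ :=
    Real.sq_sqrt (by positivity)
  have squared := hrun.mul_sq_mul_reach_le hconc hι (by linarith) hWK hh
    (s := s) (a := a) (B := √(800 * (H ^ 5 * W * L) / Kδ)) (Real.sqrt_pos.2 (by positivity)) ?_ ?_
  · rw [mul_pow, B_sq, mul_left_comm, ← Kδ_def, div_mul_cancel₀ _ Kδ_pos.ne'] at squared
    have : 0 < H ^ 5 * W * L := by positivity
    linarith
  · rw [Real.sqrt_le_left (by positivity), div_le_iff₀ Kδ_pos]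
    calc 800 * (H ^ 5 * W * L) = H ^ 2 * (800 * (H ^ 3 * W * L)) := by ring
      _ ≤ H ^ 2 * Kδ := by gcongr
  · intro t ht htn
    refine sqrt_div_le_two_mul_bonus (by linarith) Kδ_pos ht (le_trans ?_ hlt.le)
    gcongr

end IsRun

end Count

section Confidence

variable {p : ℝ}

theorem log_natCast_div_nonneg (n : ℕ) (hp : 0 < p) (hp1 : p ≤ 1) : 0 ≤ Real.log (n / p) := by
  rcases n.eq_zero_or_pos with rfl | hn
  · simp
  · exact Real.log_nonneg ((one_le_div₀ hp).2 (hp1.trans (by exact_mod_cast hn)))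

theorem sq_mul_exp_neg_two_mul_log_le (n : ℕ) (hp : 0 < p) (hp1 : p ≤ 1) :
    (n : ℝ) ^ 2 * Real.exp (-(2 * Real.log (n / p))) ≤ p := by
  rcases n.eq_zero_or_pos with rfl | hn
  · simpa using hp.le
  · have n_pos : (0 : ℝ) < n := Nat.cast_pos.2 hn
    have exp_eq : Real.exp (-(2 * Real.log (n / p))) = (p / n) ^ 2 := by
      rw [← mul_neg, ← Real.log_inv, inv_div, mul_comm, Real.exp_mul,
        Real.exp_log (div_pos hp n_pos), Real.rpow_two]
    calc (n : ℝ) ^ 2 * Real.exp (-(2 * Real.log (n / p))) = p ^ 2 := by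
          rw [exp_eq]
          field_simp
      _ ≤ p := pow_le_of_le_one hp.le hp1 two_ne_zero

variable {S A : Type*} [Fintype S] [Fintype A]

variable (S A) in
/-- The logarithm `ι = log (S A H K / p)` that sets the width of the confidence intervals; it is
`0` when `S A H K = 0`. -/
def iota (H K : ℕ) (p : ℝ) : ℝ :=
  Real.log ((Fintype.card S * Fintype.card A * H * K : ℕ) / p)

theorem iota_nonneg (H K : ℕ) (hp : 0 < p) (hp1 : p ≤ 1) : 0 ≤ iota S A H K p :=
  log_natCast_div_nonneg _ hp hp1

theorem half_le_iota {H K : ℕ} (hp : 0 < p) (hp1 : p ≤ 1)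
    (htwo : 2 ≤ Fintype.card S * Fintype.card A * H * K) : 1 / 2 ≤ iota S A H K p := by
  have two_le : (2 : ℝ) ≤ (Fintype.card S * Fintype.card A * H * K : ℕ) / p :=
    (by exact_mod_cast htwo : (2 : ℝ) ≤ (Fintype.card S * Fintype.card A * H * K : ℕ)).trans
      (le_div_self (Nat.cast_nonneg _) hp hp1)
  linarith [Real.log_two_gt_d9, Real.log_le_log two_pos two_le, iota.eq_def S A H K p]

theorem iota_le_logFactor (H N K : ℕ) (p : ℝ) : iota S A H K p ≤ logFactor S A H N K p := by
  rw [iota, logFactor]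
  push_cast
  exact le_add_of_nonneg_left (Real.log_natCast_nonneg N)

theorem mul_exp_neg_two_mul_iota_le (H K : ℕ) (hp : 0 < p) (hp1 : p ≤ 1) :
    ((H ^ 2 * Fintype.card S ^ 2 * Fintype.card A * K : ℕ) : ℝ≥0∞)
      * ENNReal.ofReal (Real.exp (-(2 * iota S A H K p))) ≤ ENNReal.ofReal p := by
  rw [← ENNReal.ofReal_natCast, ← ENNReal.ofReal_mul (Nat.cast_nonneg _)]
  refine ENNReal.ofReal_le_ofReal
    (le_trans ?_ (sq_mul_exp_neg_two_mul_log_le (Fintype.card S * Fintype.card A * H * K) hp hp1))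
  rw [iota]
  gcongr
  rw [← Nat.cast_pow, Nat.cast_le]
  calc H ^ 2 * Fintype.card S ^ 2 * Fintype.card A * K
      ≤ H ^ 2 * Fintype.card S ^ 2 * Fintype.card A ^ 2 * K ^ 2 := by
        gcongr <;> exact Nat.le_self_pow two_ne_zero _
    _ = (Fintype.card S * Fintype.card A * H * K) ^ 2 := by ring

end Confidence

section Guarantee

variable {S A : Type*} [Fintype S] [DecidableEq S] [Fintype A] [DecidableEq A] [Nonempty A]
  {M : EpisodicMDP S A} {N K : ℕ} {p : ℝ}

theorem IsRun.mul_reach_sq_div_le_visits {l : History S A} (hp : 0 < p) (hp1 : p ≤ 1)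
    (hrun : IsRun M 1 (logFactor S A M.H N K p) K 1 M.s₁ l)
    (hconc : Concentrated M (iota S A M.H K p) l) {h : ℕ} (hh : h ∈ Set.Icc 1 M.H) (s : S) (a : A)
    (hK : 800 * (M.H ^ 3 * (Fintype.card S * Fintype.card A) * logFactor S A M.H N K p)
      ≤ K * reach M h s ^ 2) :
    1 / 200 * (K * reach M h s ^ 2 / (M.H ^ 2 * (Fintype.card S * Fintype.card A)))
      ≤ visits h s a l := by
  have ⟨one_le_h, h_le⟩ := hh
  rcases le_or_gt 2 (Fintype.card S * Fintype.card A * M.H * K) with htwo | hone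
  · exact hrun.mul_reach_sq_div_le_visits_of_half_le hconc (iota_le_logFactor _ _ _ _)
      ((half_le_iota hp hp1 htwo).trans (iota_le_logFactor _ _ _ _)) hh s a hK
  · rcases K.eq_zero_or_pos with rfl | K_pos
    · simp
    have : Nonempty S := ⟨s⟩
    have card_mul : Fintype.card S * Fintype.card A = 1 := by
      refine le_antisymm (le_trans ?_ (Nat.lt_succ_iff.1 hone))
        (Nat.mul_pos Fintype.card_pos Fintype.card_pos)
      rw [mul_assoc _ M.H]
      exact Nat.le_mul_of_pos_right _ (Nat.mul_pos (one_le_h.trans h_le) K_pos)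
    have card_S := Nat.eq_one_of_mul_eq_one_right card_mul
    have card_A := Nat.eq_one_of_mul_eq_one_left card_mul
    have := Fintype.card_le_one_iff_subsingleton.1 card_S.le
    have := Fintype.card_le_one_iff_subsingleton.1 card_A.le
    have reach_sq_le : reach M h s ^ 2 ≤ 1 :=
      pow_le_one₀ (relReach_nonneg M 1 h _ s) (relReach_le_one M 1 h _ s)
    have one_le_H : (1 : ℝ) ≤ M.H := by exact_mod_cast one_le_h.trans h_le
    rw [hrun.visits_eq_of_subsingleton hh, card_S, card_A, Nat.cast_one, mul_one, mul_one]
    calc 1 / 200 * (K * reach M h s ^ 2 / M.H ^ 2) ≤ 1 * (K * 1 / 1) := by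
          gcongr
          · norm_num
          · exact one_le_pow₀ one_le_H
      _ = K := by ring

theorem ofReal_one_sub_le_toOuterMeasure_concentrated {g : ActionRule S A} (hp : 0 < p)
    (hp1 : p ≤ 1) (hg : IsGreedy g) :
    ENNReal.ofReal (1 - p) ≤ (ucbZero M 1 N K p g).toOuterMeasure
      {m | ∃ l, m = replay M.H 1 (logFactor S A M.H N K p) l
        ∧ IsRun M 1 (logFactor S A M.H N K p) K 1 M.s₁ l
        ∧ Concentrated M (iota S A M.H K p) l} := by
  refine ofReal_one_sub_le_toOuterMeasure _ hp.le
    ((toOuterMeasure_not_concentrated_le M 1 _ g K K (iota_nonneg M.H K hp hp1)).trans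
      (mul_exp_neg_two_mul_iota_le M.H K hp hp1)) fun m hm hgood => ?_
  obtain ⟨l, rfl, hrun⟩ := exists_isRun_of_mem_support_runEpisodes hg hm
  refine ⟨l, rfl, hrun, ?_⟩
  by_contra hconc
  refine hgood ⟨?_, ?_⟩
  · rw [replay_data]
    exact fun h hh s a => hrun.visits_le hh s a
  · rwa [replay_data]

end Guarantee

end UCBZero

end

theorem theorem2 :
    ∃ c C₁ C₂ : ℝ, 0 < c ∧ 0 < C₁ ∧ 0 < C₂ ∧
      ∀ (S A : Type*) [Fintype S] [DecidableEq S] [Fintype A] [DecidableEq A] [Nonempty A]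
        (M : UCBZero.EpisodicMDP S A) (N K : ℕ) (p : ℝ) (g : UCBZero.ActionRule S A),
        1 ≤ N → 0 < p → p < 1 → UCBZero.IsGreedy g →
        ENNReal.ofReal (1 - p) ≤
          (UCBZero.ucbZero M c N K p g).toOuterMeasure
            {m | ∀ (s : S) (a : A) (h : ℕ), 1 ≤ h → h ≤ M.H →
              C₁ * ((M.H : ℝ) ^ 3 * Fintype.card S * Fintype.card A
                  * UCBZero.logFactor S A M.H N K p) ≤ K * UCBZero.reach M h s ^ 2 →
              C₂ * (K * UCBZero.reach M h s ^ 2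
                  / ((M.H : ℝ) ^ 2 * Fintype.card S * Fintype.card A)) ≤ m.count h s a} := by
  refine ⟨1, 800, 1 / 200, by norm_num, by norm_num, by norm_num,
    fun S A _ _ _ _ _ M N K p g _ hp hp1 hg => ?_⟩
  refine (UCBZero.ofReal_one_sub_le_toOuterMeasure_concentrated hp hp1.le hg).trans
    (MeasureTheory.measure_mono ?_)
  rintro _ ⟨l, rfl, hrun, hconc⟩ s a h one_le_h h_le hK
  rw [UCBZero.replay_count, mul_assoc ((M.H : ℝ) ^ 2)]
  rw [mul_assoc ((M.H : ℝ) ^ 3)] at hK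
  exact hrun.mul_reach_sq_div_le_visits hp hp1.le hconc ⟨one_le_h, h_le⟩ s a hK
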